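/- Let $K\colon S^1\to\mathbb{R}^3$ be a smooth knot, i.e. a $C^\infty$ embedding, and let $x_0\in K(S^1)$. Then for every integer $n\ge 1$ there are $n$ pairwise distinct points $y_0,\dots,y_{n-1}\in K(S^1)$, lying on $K$ in cyclic order (that is, the images under $K$ of points that follow one another in cyclic order on $S^1$), such that the Euclidean distances $\|y_{i}-y_{i-1}\|$, $i=1,\dots,n$, where $y_n=y_0$, are all equal, and such that $x_0$ is one of the points $y_0,\dots,y_{n-1}$. In other words, there is a regular $n$-gon inscribed in $K$ having $x_0$ as a vertex. -/

import Mathlib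

open scoped Manifold ContDiff

/-- A smooth knot: a smooth (`C^∞`) embedding of the circle `S¹` into Euclidean `ℝ³`, i.e. a
`C^∞` immersion which is a homeomorphism onto its image. -/
def IsSmoothKnot (K : Circle → EuclideanSpace ℝ (Fin 3)) : Prop :=
  Manifold.IsSmoothEmbedding (𝓡 1) (𝓡 3) ∞ K

/-- The points `p 0, …, p (n-1)` of the circle are pairwise distinct and lie on it in
(counterclockwise) cyclic order: they have angles `t 0 < t 1 < … < t (n-1)`, all within one
turn, i.e. `t (n-1) < t 0 + 2π`. -/
def InCyclicOrder {n : ℕ} (p : Fin n → Circle) : Prop :=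
  ∃ t : Fin n → ℝ, StrictMono t ∧ (∀ i j, t j < t i + 2 * Real.pi) ∧
    ∀ i, Circle.exp (t i) = p i

/-- `x 0, …, x (n-1)` are the vertices of a regular `n`-gon inscribed in the closed curve `K`:
they are the images of points in cyclic order on the circle, and the distances between
consecutive vertices are all the same. Here `i + 1` is taken modulo `n`, so that the last
vertex is followed by `x 0`. -/
structure IsInscribedRegularPolygon (K : Circle → EuclideanSpace ℝ (Fin 3))
    {n : ℕ} [NeZero n] (x : Fin n → EuclideanSpace ℝ (Fin 3)) : Prop where
  cyclic : ∃ p : Fin n → Circle, InCyclicOrder p ∧ ∀ i, K (p i) = x i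
  equal_sides : ∃ d : ℝ, ∀ i, dist (x i) (x (i + 1)) = d

/-! Cut the circle at the parameter of `x₀` into `n` consecutive arcs with proportions `s` in the
standard simplex, and let `f i s` be the chord of the `i`-th arc. The closed sets where `f i` is the
least chord cover the simplex, so the dual KKM theorem
(`exists_mem_stdSimplex_forall_eq_zero_or_mem`) gives an `s` lying in the `i`-th set whenever `s i ≠
0`. If `s i = 0`, the chord vanishes and is least anyway; hence all chords are equal.

The danger is a degenerate solution: at a vertex of the simplex one arc is the whole circle and all
chords are zero. The sets are therefore cut down by `s i ≤ 1 - ε`. They still cover: the chord of a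
nearly full arc is also the chord of its short complement near `x₀`, which contains all other arcs,
and there larger arcs have no shorter chords (`HasStrictDerivAt.exists_dist_le_dist`, from the
nonzero derivative of an immersion). A common chord of length zero would now make every `s i` an
integer in `[0, 1)`, against `∑ i, s i = 1`.

Dual KKM is the limit of a statement on finite grids, which follows from Scarf's lemma, a parity
count. -/

/-! ### Scarf's combinatorial lemma -/

section Scarf

variable {Y I β : Type*} [LinearOrder β]

/-- A finite set `S` is dominant for a family of orders, given by the rank functions `r i`, if no
point is strictly above the minimum of `S` in every one of the orders. -/
def Dominant (r : I → Y → β) (S : Finset Y) : Prop :=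
  ∀ x, ∃ i, ∀ y ∈ S, r i x ≤ r i y

theorem Dominant.mono {r : I → Y → β} {S T : Finset Y} (hS : Dominant r S) (h : T ⊆ S) :
    Dominant r T := fun x ↦
  let ⟨i, hi⟩ := hS x
  ⟨i, fun y hy ↦ hi y (h hy)⟩

/-- `x` is the largest in the order `k` among the points which are above `m l` in every other
order `l`. -/
def IsTopAbove (r : I → Y → β) (m : I → Y) (k : I) (x : Y) : Prop :=
  (∀ l, l ≠ k → r l (m l) < r l x) ∧
    ∀ z, (∀ l, l ≠ k → r l (m l) < r l z) → r k z ≤ r k x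

theorem Finset.exists_min_family {S : Finset Y} (hS : S.Nonempty) (r : I → Y → β) :
    ∃ m : I → Y, (∀ i, m i ∈ S) ∧ ∀ i, ∀ y ∈ S, r i (m i) ≤ r i y := by
  choose m hm using fun i ↦ S.exists_min_image (r i) hS
  exact ⟨m, fun i ↦ (hm i).1, fun i ↦ (hm i).2⟩

theorem Dominant.exists_eq_min {r : I → Y → β} (hr : ∀ i, Function.Injective (r i))
    {S : Finset Y} (hS : Dominant r S) {m : I → Y} (hm : ∀ i, m i ∈ S)
    (hmin : ∀ i, ∀ y ∈ S, r i (m i) ≤ r i y) {y : Y} (hy : y ∈ S) : ∃ i, m i = y := by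
  obtain ⟨i, hi⟩ := hS y
  exact ⟨i, hr i (le_antisymm (hmin i y hy) (hi _ (hm i)))⟩

theorem IsTopAbove.unique {r : I → Y → β} (hr : ∀ i, Function.Injective (r i)) {m : I → Y} {k : I}
    {x y : Y} (hx : IsTopAbove r m k x) (hy : IsTopAbove r m k y) : x = y :=
  hr k (le_antisymm (hy.2 x hx.1) (hx.2 y hy.1))

theorem IsTopAbove.exists_of [Finite Y] {r : I → Y → β} {m : I → Y} {k : I} {z : Y}
    (hz : ∀ l, l ≠ k → r l (m l) < r l z) : ∃ x, IsTopAbove r m k x := by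
  obtain ⟨x, hx, h⟩ := Set.exists_max_image {z | ∀ l, l ≠ k → r l (m l) < r l z} (r k)
    (Set.toFinite _) ⟨z, hz⟩
  exact ⟨x, hx, fun z hz ↦ h z hz⟩

/-- Since `x` exceeds `m l` for `l ≠ k`, dominance of `T` at `x` can only occur in the order `k`, so
`x` is below `T` there, and so are the points competing with `x`. Any other point is below some `m
l` with `l ≠ k`, hence below both `T` and `x` in that order. -/
theorem IsTopAbove.dominant_insert [DecidableEq Y] {r : I → Y → β} {T : Finset Y}
    (hT : Dominant r T) {m : I → Y} (hm : ∀ i, m i ∈ T) (hmin : ∀ i, ∀ y ∈ T, r i (m i) ≤ r i y)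
    {k : I} {x : Y} (hx : IsTopAbove r m k x) : Dominant r (insert x T) := by
  intro z
  by_cases hz : ∀ l, l ≠ k → r l (m l) < r l z
  · refine ⟨k, fun y hy ↦ ?_⟩
    have hzx := hx.2 z hz
    rcases Finset.mem_insert.1 hy with rfl | hy
    · exact hzx
    · obtain ⟨l, hl⟩ := hT x
      by_cases hlk : l = k
      · subst hlk
        exact hzx.trans (hl y hy)
      · exact absurd (hl _ (hm l)) (not_le.2 (hx.1 l hlk))
  · push Not at hz
    obtain ⟨l, hlk, hl⟩ := hz
    refine ⟨l, fun y hy ↦ ?_⟩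
    rcases Finset.mem_insert.1 hy with rfl | hy
    · exact hl.trans (hx.1 l hlk).le
    · exact hl.trans (hmin l y hy)

/-- By counting, the enlarged set has a different minimum in each order. So `x` is the minimum in
exactly one order, the other minima are unchanged, and the coincidence `m i = m j` must be broken at
`i` or `j`. -/
theorem Dominant.isTopAbove_of_insert [Fintype I] [DecidableEq Y] {r : I → Y → β}
    (hr : ∀ i, Function.Injective (r i)) {T : Finset Y} (hcard : T.card + 1 = Fintype.card I)
    {m : I → Y} (hm : ∀ i, m i ∈ T) (hmin : ∀ i, ∀ y ∈ T, r i (m i) ≤ r i y)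
    {i j : I} (hij : i ≠ j) (hmij : m i = m j)
    {x : Y} (hxT : x ∉ T) (hx : Dominant r (insert x T)) :
    IsTopAbove r m i x ∨ IsTopAbove r m j x := by
  obtain ⟨m', hm', hmin'⟩ := Finset.exists_min_family (Finset.insert_nonempty x T) r
  have hinj : Function.Injective m' := by
    have himg : Finset.univ.image m' = insert x T := by
      ext y
      simp only [Finset.mem_image, Finset.mem_univ, true_and]
      exact ⟨fun ⟨i, hi⟩ ↦ hi ▸ hm' i, fun hy ↦ hx.exists_eq_min hr hm' hmin' hy⟩
    have := Finset.card_image_iff (s := Finset.univ) (f := m')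
    rw [himg, Finset.card_insert_of_notMem hxT, hcard, Finset.card_univ] at this
    simpa [Set.injOn_univ] using this.1 rfl
  obtain ⟨k, hk⟩ := hx.exists_eq_min hr hm' hmin' (Finset.mem_insert_self x T)
  have heq : ∀ l, l ≠ k → m' l = m l := by
    intro l hl
    have hl' : m' l ∈ T := Finset.mem_of_mem_insert_of_ne (hm' l) fun h ↦ hl (hinj (h.trans hk.symm))
    exact hr l (le_antisymm (hmin' l _ (Finset.mem_insert_of_mem (hm l))) (hmin l _ hl'))
  have htop : IsTopAbove r m k x := by
    refine ⟨fun l hl ↦ ?_, fun z hz ↦ ?_⟩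
    · rw [← heq l hl]
      refine lt_of_le_of_ne (hmin' l x (Finset.mem_insert_self x T)) fun h ↦ hl ?_
      exact hinj ((hr l h).trans hk.symm)
    · obtain ⟨l, hl⟩ := hx z
      by_cases hlk : l = k
      · exact hlk ▸ hl x (Finset.mem_insert_self x T)
      · exact absurd (hl _ (Finset.mem_insert_of_mem (hm l))) (not_le.2 (hz l hlk))
  by_cases hki : k = i
  · exact Or.inl (hki ▸ htop)
  by_cases hkj : k = j
  · exact Or.inr (hkj ▸ htop)
  exact absurd (hinj (by rw [heq i (Ne.symm hki), heq j (Ne.symm hkj), hmij])) hij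

/-- Slack elements `e i`: the element `e i` is the least one in the order `i`, and is above all
elements other than slack elements in the other orders. -/
structure IsSlack (r : I → Y → β) (e : I → Y) : Prop where
  lt : ∀ i y, y ≠ e i → r i (e i) < r i y
  lt_of_notMem_range : ∀ i j x, i ≠ j → x ∉ Set.range e → r i x < r i (e j)

-- Two orders share a minimum of `T`, and a new point can take over either of them, in one way each.
-- The non-slack `x` ensures that candidates exist: `e k` is above it in every order but `k`.
open Classical in
theorem Dominant.card_insert_eq_two [Fintype I] [Fintype Y] {r : I → Y → β}
    (hr : ∀ i, Function.Injective (r i)) {e : I → Y} (he : IsSlack r e)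
    {T : Finset Y} (hcard : T.card + 1 = Fintype.card I)
    {x : Y} (hxT : x ∈ T) (hx : x ∉ Set.range e) (hT : Dominant r T) :
    (Finset.univ.filter fun x ↦ x ∉ T ∧ Dominant r (insert x T)).card = 2 := by
  obtain ⟨m, hm, hmin⟩ := Finset.exists_min_family ⟨x, hxT⟩ r
  obtain ⟨i, j, hij, hmij⟩ : ∃ i j, i ≠ j ∧ m i = m j := by
    obtain ⟨i, -, j, -, hij, h⟩ := Finset.exists_ne_map_eq_of_card_lt_of_maps_to
      (s := Finset.univ) (t := T) (f := m) (by rw [Finset.card_univ]; omega) (fun i _ ↦ hm i)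
    exact ⟨i, j, hij, h⟩
  have hex : ∀ k, ∃ x, IsTopAbove r m k x := fun k ↦
    IsTopAbove.exists_of (z := e k) fun l hl ↦
      (hmin l x hxT).trans_lt (he.lt_of_notMem_range l k x hl hx)
  have hsurj : ∀ {k k' : I}, k ≠ k' → m k = m k' → ∀ {x}, IsTopAbove r m k x → x ∉ T := by
    intro k k' hne hkk' x hx hxT
    obtain ⟨l, rfl⟩ := hT.exists_eq_min hr hm hmin hxT
    by_cases hl : l = k
    · subst hl
      have := hx.1 k' hne.symm
      rw [hkk'] at this
      exact this.false
    · exact (hx.1 l hl).false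
  obtain ⟨a, ha⟩ := hex i
  obtain ⟨b, hb⟩ := hex j
  have hab : a ≠ b := by
    rintro rfl
    obtain ⟨l, hl⟩ := hT a
    by_cases hli : l = i
    · exact absurd (hl _ (hm l)) (not_le.2 (hb.1 l (hli ▸ hij)))
    · exact absurd (hl _ (hm l)) (not_le.2 (ha.1 l hli))
  rw [← Finset.card_pair hab]
  congr 1
  ext x
  simp only [Finset.mem_filter, Finset.mem_univ, true_and, Finset.mem_insert,
    Finset.mem_singleton]
  constructor
  · rintro ⟨hxT, hx⟩
    rcases hx.isTopAbove_of_insert hr hcard hm hmin hij hmij hxT with h | h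
    · exact Or.inl (h.unique hr ha)
    · exact Or.inr (h.unique hr hb)
  · rintro (rfl | rfl)
    · exact ⟨hsurj hij hmij ha, ha.dominant_insert hT hm hmin⟩
    · exact ⟨hsurj hij.symm hmij.symm hb, hb.dominant_insert hT hm hmin⟩

-- This is the boundary case. Points outside `T` lie above `e l` in each order `l ≠ i₀`, so
-- dominance must use the order `i₀`, and the added point has to be the largest one there outside
-- `T`.
open Classical in
theorem IsSlack.card_insert_eq_one [Fintype I] [Fintype Y] {r : I → Y → β}
    (hr : ∀ i, Function.Injective (r i)) {e : I → Y} (he : IsSlack r e)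
    (hinj : Function.Injective e) (i₀ : I) {T : Finset Y} (hT : T = (Finset.univ.erase i₀).image e) :
    (Finset.univ.filter fun x ↦ x ∉ T ∧ Dominant r (insert x T)).card = 1 := by
  have hmem : ∀ z, z ∈ T ↔ ∃ l, l ≠ i₀ ∧ e l = z := by
    intro z
    simp [hT]
  obtain ⟨a, haT, ha⟩ := Set.exists_max_image {z | z ∉ T} (r i₀) (Set.toFinite _)
    ⟨e i₀, by rw [Set.mem_ofPred_eq, hmem]; rintro ⟨l, hl, h⟩; exact hl (hinj h)⟩
  rw [Finset.card_eq_one]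
  refine ⟨a, ?_⟩
  ext x
  simp only [Finset.mem_filter, Finset.mem_univ, true_and, Finset.mem_singleton]
  constructor
  · rintro ⟨hxT, hx⟩
    refine hr i₀ (le_antisymm (ha x hxT) ?_)
    obtain ⟨l, hl⟩ := hx a
    by_cases hli : l = i₀
    · exact hli ▸ hl x (Finset.mem_insert_self x T)
    · have hel : e l ∈ T := (hmem _).2 ⟨l, hli, rfl⟩
      have hne : a ≠ e l := fun h ↦ haT (h ▸ hel)
      exact absurd (hl _ (Finset.mem_insert_of_mem hel)) (not_le.2 (he.lt l a hne))
  · rintro rfl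
    refine ⟨haT, fun z ↦ ?_⟩
    by_cases hz : z ∈ T
    · obtain ⟨l, -, rfl⟩ := (hmem z).1 hz
      refine ⟨l, fun y _ ↦ ?_⟩
      by_cases hy : y = e l
      · rw [hy]
      · exact (he.lt l y hy).le
    · refine ⟨i₀, fun y hy ↦ ?_⟩
      rcases Finset.mem_insert.1 hy with rfl | hy
      · exact ha z hz
      obtain ⟨l, hl, rfl⟩ := (hmem y).1 hy
      by_cases hzr : z ∈ Set.range e
      · obtain ⟨k, rfl⟩ := hzr
        have hk : k = i₀ := by
          by_contra hk
          exact hz ((hmem _).2 ⟨k, hk, rfl⟩)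
        subst hk
        exact (he.lt k _ fun h ↦ hl (hinj h)).le
      · exact (he.lt_of_notMem_range i₀ l z hl.symm hzr).le

open Classical in
theorem card_dominant_supersets [Fintype I] [Fintype Y] (r : I → Y → β)
    {T : Finset Y} (hcard : T.card + 1 = Fintype.card I) :
    (Finset.univ.filter fun S : Finset Y ↦
      (S.card = Fintype.card I ∧ Dominant r S) ∧ T ⊆ S).card =
    (Finset.univ.filter fun x ↦ x ∉ T ∧ Dominant r (insert x T)).card := by
  symm
  refine Finset.card_bij (fun x _ ↦ insert x T) ?_ ?_ ?_
  · intro x hx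
    simp only [Finset.mem_filter, Finset.mem_univ, true_and] at hx ⊢
    exact ⟨⟨by rw [Finset.card_insert_of_notMem hx.1, hcard], hx.2⟩, Finset.subset_insert _ _⟩
  · intro x hx y hy h
    simp only [Finset.mem_filter, Finset.mem_univ, true_and] at hx hy
    have : x ∈ insert y T := h ▸ Finset.mem_insert_self x T
    exact (Finset.mem_insert.1 this).resolve_right hx.1
  · intro S hS
    simp only [Finset.mem_filter, Finset.mem_univ, true_and] at hS
    obtain ⟨⟨hSc, hSd⟩, hTS⟩ := hS
    obtain ⟨x, hx⟩ : ∃ x, S \ T = {x} := by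
      rw [← Finset.card_eq_one, Finset.card_sdiff_of_subset hTS]
      omega
    have hxS : x ∈ S \ T := hx ▸ Finset.mem_singleton_self x
    have hins : insert x T = S := by
      rw [← Finset.sdiff_union_of_subset hTS, hx, Finset.insert_eq]
    rw [Finset.mem_sdiff] at hxS
    refine ⟨x, ?_, hins⟩
    simp only [Finset.mem_filter, Finset.mem_univ, true_and]
    exact ⟨hxS.2, hins ▸ hSd⟩

-- If removing `a` leaves every colour but `i₀` exactly once, then `a` repeats the colour of a
-- unique other element `b`, and only `a` and `b` can be removed in this way.
open Classical in
theorem even_card_subsets_of_image_ne_univ [Fintype I] [Fintype Y] {c : Y → I} (i₀ : I)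
    {S : Finset Y} (hcard : S.card = Fintype.card I) (hS : S.image c ≠ Finset.univ) :
    Even (Finset.univ.filter fun T : Finset Y ↦
      (T.card + 1 = Fintype.card I ∧ T.image c = Finset.univ.erase i₀) ∧ T ⊆ S).card := by
  have hpair : (Finset.univ.filter fun T : Finset Y ↦
      (T.card + 1 = Fintype.card I ∧ T.image c = Finset.univ.erase i₀) ∧ T ⊆ S).card =
      (S.filter fun x ↦ (S.erase x).image c = Finset.univ.erase i₀).card := by
    symm
    refine Finset.card_bij (fun x _ ↦ S.erase x) ?_ ?_ ?_
    · intro x hx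
      simp only [Finset.mem_filter, Finset.mem_univ, true_and] at hx ⊢
      exact ⟨⟨by rw [Finset.card_erase_add_one hx.1, hcard], hx.2⟩, Finset.erase_subset _ _⟩
    · intro x hx y hy h
      simp only [Finset.mem_filter] at hx hy
      exact (Finset.erase_inj S hx.1).1 h
    · intro T hT
      simp only [Finset.mem_filter, Finset.mem_univ, true_and] at hT
      obtain ⟨⟨hTc, hTi⟩, hTS⟩ := hT
      obtain ⟨x, hx⟩ : ∃ x, S \ T = {x} := by
        rw [← Finset.card_eq_one, Finset.card_sdiff_of_subset hTS]
        omega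
      have hxS : x ∈ S \ T := hx ▸ Finset.mem_singleton_self x
      have her : S.erase x = T := by
        rw [← Finset.sdiff_singleton_eq_erase, ← hx, Finset.sdiff_sdiff_eq_self hTS]
      refine ⟨x, ?_, her⟩
      simp only [Finset.mem_filter]
      exact ⟨(Finset.mem_sdiff.1 hxS).1, her ▸ hTi⟩
  rw [hpair]
  rcases Finset.eq_empty_or_nonempty
    (S.filter fun x ↦ (S.erase x).image c = Finset.univ.erase i₀) with h0 | ⟨a, ha⟩
  · rw [h0]
    simp
  obtain ⟨haS, ha⟩ := Finset.mem_filter.1 ha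
  have hinj : Set.InjOn c (S.erase a : Finset Y) := by
    rw [← Finset.card_image_iff, ha, Finset.card_erase_of_mem (Finset.mem_univ _),
      Finset.card_erase_of_mem haS, hcard, Finset.card_univ]
  have hca : c a ≠ i₀ := by
    intro h
    apply hS
    rw [← Finset.insert_erase haS, Finset.image_insert, ha, h]
    exact Finset.insert_erase (Finset.mem_univ _)
  obtain ⟨b, hb, hbc⟩ : ∃ b ∈ S.erase a, c b = c a := by
    have : c a ∈ (S.erase a).image c := by
      rw [ha]
      exact Finset.mem_erase.2 ⟨hca, Finset.mem_univ _⟩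
    simpa only [Finset.mem_image] using this
  have hba := (Finset.mem_erase.1 hb).1
  have hbS := (Finset.mem_erase.1 hb).2
  suffices h : (S.filter fun x ↦ (S.erase x).image c = Finset.univ.erase i₀) = {a, b} by
    rw [h, Finset.card_pair hba.symm]
    exact even_two
  ext x
  simp only [Finset.mem_filter, Finset.mem_insert, Finset.mem_singleton]
  constructor
  · rintro ⟨hxS, hx⟩
    by_contra! hne
    have hxa : x ∈ S.erase a := Finset.mem_erase.2 ⟨hne.1, hxS⟩
    have hcx : c x ∈ (S.erase x).image c := by
      rw [hx, ← ha]
      exact Finset.mem_image_of_mem c hxa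
    obtain ⟨y, hy, hyx⟩ := Finset.mem_image.1 hcx
    obtain ⟨hyne, hyS⟩ := Finset.mem_erase.1 hy
    by_cases hya : y = a
    · subst hya
      exact hne.2 (hinj hxa hb (hyx.symm.trans hbc.symm))
    · exact hyne (hinj (Finset.mem_erase.2 ⟨hya, hyS⟩) hxa hyx)
  · rintro (rfl | rfl)
    · exact ⟨haS, ha⟩
    · refine ⟨hbS, ?_⟩
      rw [← ha]
      ext i
      simp only [Finset.mem_image, Finset.mem_erase]
      constructor
      · rintro ⟨y, ⟨hy, hyS⟩, rfl⟩
        by_cases hya : y = a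
        · exact ⟨x, ⟨hba, hbS⟩, by rw [hya, hbc]⟩
        · exact ⟨y, ⟨hya, hyS⟩, rfl⟩
      · rintro ⟨y, ⟨hy, hyS⟩, rfl⟩
        by_cases hyx : y = x
        · exact ⟨a, ⟨hba.symm, haS⟩, by rw [hyx, hbc]⟩
        · exact ⟨y, ⟨hyx, hyS⟩, rfl⟩

open Classical in
/-- **Scarf's lemma**: for every colouring of a finite set with slack elements, which colours the
slack elements by their own index, there is a dominant set bearing every colour exactly once. -/
theorem IsSlack.exists_dominant_image_eq_univ [Fintype I] [Nonempty I] [Fintype Y]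
    {r : I → Y → β} (hr : ∀ i, Function.Injective (r i)) {e : I → Y} (he : IsSlack r e)
    {c : Y → I} (hc : ∀ i, c (e i) = i) :
    ∃ S : Finset Y, Dominant r S ∧ S.image c = Finset.univ := by
  obtain ⟨i₀⟩ := ‹Nonempty I›
  have hinj : Function.Injective e := fun i j h ↦ by rw [← hc i, ← hc j, h]
  by_contra! hno
  -- Count the incidences `T ⊆ S` between doors and rooms. Without a fully coloured room each room
  -- has an even number of doors, while every door opens on 0 or 2 rooms, except the slack door,
  -- which opens on one.
  let rooms := Finset.univ.filter fun S : Finset Y ↦ S.card = Fintype.card I ∧ Dominant r S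
  let doors := Finset.univ.filter fun T : Finset Y ↦
    T.card + 1 = Fintype.card I ∧ T.image c = Finset.univ.erase i₀
  have hcount := Finset.sum_card_bipartiteAbove_eq_sum_card_bipartiteBelow
    (s := doors) (t := rooms) (fun T S ↦ T ⊆ S)
  have hR : Even (∑ S ∈ rooms, (Finset.bipartiteBelow (fun T S ↦ T ⊆ S) doors S).card) := by
    refine Finset.even_sum _ fun S hS ↦ ?_
    obtain ⟨hScard, hSd⟩ := (Finset.mem_filter.1 hS).2
    have := even_card_subsets_of_image_ne_univ (c := c) i₀ hScard
      (hno S hSd)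
    rwa [Finset.bipartiteBelow, Finset.filter_filter]
  have hL : ∀ T ∈ doors, T ≠ (Finset.univ.erase i₀).image e →
      Even (Finset.bipartiteAbove (fun T S ↦ T ⊆ S) rooms T).card := by
    intro T hT hne
    obtain ⟨hTcard, hTc⟩ := (Finset.mem_filter.1 hT).2
    rw [Finset.bipartiteAbove, Finset.filter_filter, card_dominant_supersets r hTcard]
    by_cases hTd : Dominant r T
    · obtain ⟨x, hxT, hx⟩ : ∃ x ∈ T, x ∉ Set.range e := by
        by_contra! hall
        apply hne
        rw [← hTc, Finset.image_image]
        ext y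
        simp only [Finset.mem_image, Function.comp]
        constructor
        · intro hy
          obtain ⟨l, rfl⟩ := hall y hy
          exact ⟨e l, hy, by rw [hc]⟩
        · rintro ⟨z, hz, rfl⟩
          obtain ⟨l, rfl⟩ := hall z hz
          rwa [hc]
      rw [hTd.card_insert_eq_two hr he hTcard hxT hx]
      exact even_two
    · rw [Finset.filter_false_of_mem]
      · simp
      · rintro x - ⟨-, hx⟩
        exact hTd (hx.mono (Finset.subset_insert _ _))
  have hT₀ : (Finset.univ.erase i₀).image e ∈ doors := by
    simp only [doors, Finset.mem_filter, Finset.mem_univ, true_and]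
    refine ⟨?_, ?_⟩
    · rw [Finset.card_image_of_injective _ hinj, Finset.card_erase_add_one (Finset.mem_univ _),
        Finset.card_univ]
    · rw [Finset.image_image, show c ∘ e = id from funext hc, Finset.image_id]
  have hone : (Finset.bipartiteAbove (fun T S ↦ T ⊆ S) rooms
      ((Finset.univ.erase i₀).image e)).card = 1 := by
    rw [Finset.bipartiteAbove, Finset.filter_filter,
      card_dominant_supersets r (Finset.mem_filter.1 hT₀).2.1]
    exact he.card_insert_eq_one hr hinj i₀ rfl
  rw [← Finset.add_sum_erase _ _ hT₀, hone] at hcount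
  rw [← hcount] at hR
  have hE : Even (∑ T ∈ doors.erase ((Finset.univ.erase i₀).image e),
      (Finset.bipartiteAbove (fun T S ↦ T ⊆ S) rooms T).card) :=
    Finset.even_sum _ fun T hT ↦ hL T (Finset.mem_of_mem_erase hT) (Finset.ne_of_mem_erase hT)
  obtain ⟨a, ha⟩ := hR
  obtain ⟨b, hb⟩ := hE
  omega

end Scarf

/-! ### The dual KKM theorem -/

section DualKKM

variable {I : Type*} [Fintype I]

theorem Finset.le_add_of_sum_le {m y : I → ℕ} {n : ℕ} (hle : ∀ i, m i ≤ y i)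
    (hsum : ∑ i, y i ≤ ∑ i, m i + n) (j : I) : y j ≤ m j + n := by
  classical
  rw [← Finset.add_sum_erase _ y (Finset.mem_univ j),
    ← Finset.add_sum_erase _ m (Finset.mem_univ j)] at hsum
  have := Finset.sum_le_sum fun i (_ : i ∈ Finset.univ.erase j) ↦ hle i
  omega

/-- The rank functions on the points of a grid in the simplex `∑ i, a i = N`, completed by slack
elements: the order `i` compares the `i`-th coordinates, and `enc` is used to break ties. -/
noncomputable def gridRank {X : Type*} (N : ℕ) (coord : X → I → ℕ) (enc : X ⊕ I → ℕ) (i : I) :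
    X ⊕ I → ℕ ×ₗ ℕ := by
  classical
  -- The shift by one leaves room for the slack value `0` below; for coordinates at most `N`, the
  -- value `N + 2` is above.
  exact Sum.elim (fun a ↦ toLex (coord a i + 1, enc (Sum.inl a)))
    fun j ↦ if j = i then toLex (0, enc (Sum.inr j)) else toLex (N + 2, enc (Sum.inr j))

omit [Fintype I] in
theorem gridRank_injective {X : Type*} (N : ℕ) (coord : X → I → ℕ) {enc : X ⊕ I → ℕ}
    (henc : Function.Injective enc) (i : I) : Function.Injective (gridRank N coord enc i) := by
  intro x y h
  apply henc
  have : ∀ x, (ofLex (gridRank N coord enc i x)).2 = enc x := by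
    rintro (a | j)
    · simp [gridRank]
    · by_cases hj : j = i <;> simp [gridRank, hj]
  rw [← this, h, this]

omit [Fintype I] in
theorem isSlack_gridRank {X : Type*} {N : ℕ} {coord : X → I → ℕ} (enc : X ⊕ I → ℕ)
    (hcoord : ∀ x i, coord x i ≤ N) : IsSlack (gridRank N coord enc) Sum.inr where
  lt i y hy := by
    rcases y with a | j
    · simp [gridRank, Prod.Lex.toLex_lt_toLex]
    · have hj : j ≠ i := fun h ↦ hy (h ▸ rfl)
      simp [gridRank, hj, Prod.Lex.toLex_lt_toLex]
  lt_of_notMem_range i j x hij hx := by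
    rcases x with a | k
    · have := hcoord a i
      simp only [gridRank, Sum.elim_inl, Sum.elim_inr, hij.symm, if_false,
        Prod.Lex.toLex_lt_toLex]
      left
      omega
    · exact absurd ⟨k, rfl⟩ hx

/-- The combinatorial form of the dual KKM theorem. -/
theorem exists_grid_point_near_colors [Nonempty I] (N : ℕ) (c : (I → ℕ) → I) :
    ∃ a : I → ℕ, ∑ i, a i = N ∧ ∀ i, a i ≤ Fintype.card I ∨
      ∃ b : I → ℕ, ∑ j, b j = N ∧ c b = i ∧
        ∀ j, a j ≤ b j + Fintype.card I ∧ b j ≤ a j + Fintype.card I := by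
  classical
  let X := {a // a ∈ Finset.piAntidiag (Finset.univ : Finset I) N}
  have hX : ∀ a : I → ℕ, a ∈ Finset.piAntidiag (Finset.univ : Finset I) N ↔ ∑ i, a i = N := by
    simp [Finset.mem_piAntidiag]
  let enc : X ⊕ I → ℕ := fun y ↦ (Fintype.equivFin (X ⊕ I) y : ℕ)
  have henc : Function.Injective enc :=
    Fin.val_injective.comp (Fintype.equivFin (X ⊕ I)).injective
  let coord : X → I → ℕ := fun a ↦ a.1
  have hcoord : ∀ x i, coord x i ≤ N := by
    intro x i
    rw [← (hX _).1 x.2]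
    exact Finset.single_le_sum (f := x.1) (fun _ _ ↦ Nat.zero_le _) (Finset.mem_univ i)
  obtain ⟨S, hS, hSc⟩ := (isSlack_gridRank enc hcoord).exists_dominant_image_eq_univ
    (gridRank_injective N coord henc) (c := Sum.elim (fun a ↦ c a.1) id) (fun i ↦ rfl)
  have hdom : ∀ x : X, ∃ i, Sum.inr i ∉ S ∧ ∀ y : X, Sum.inl y ∈ S → x.1 i ≤ y.1 i := by
    intro x
    obtain ⟨i, hi⟩ := hS (Sum.inl x)
    refine ⟨i, fun h ↦ ?_, fun y hy ↦ ?_⟩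
    · have := hi _ h
      simp [gridRank, Prod.Lex.toLex_le_toLex] at this
    · have := hi _ hy
      simp only [gridRank, Sum.elim_inl, Prod.Lex.toLex_le_toLex] at this
      change x.1 i + 1 < y.1 i + 1 ∨ x.1 i + 1 = y.1 i + 1 ∧ _ at this
      omega
  have hcol : ∀ i, Sum.inr i ∉ S → ∃ y : X, Sum.inl y ∈ S ∧ c y.1 = i := by
    intro i hi
    have hmem := Finset.mem_univ i
    rw [← hSc, Finset.mem_image] at hmem
    obtain ⟨y | j, hy, h⟩ := hmem
    · exact ⟨y, hy, h⟩
    · have hj : j = i := h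
      exact absurd (hj ▸ hy) hi
  -- Dominance tested at a corner shows that some slack element is missing from `S`; its colour is
  -- then borne by a grid point, so `S` contains one.
  obtain ⟨i₁, hi₁, -⟩ := hdom ⟨Pi.single (Classical.arbitrary I) N, by rw [hX]; simp⟩
  obtain ⟨a, ha, -⟩ := hcol i₁ hi₁
  have hmin : ∀ i, ∃ b : X, Sum.inl b ∈ S ∧ ∀ y : X, Sum.inl y ∈ S → b.1 i ≤ y.1 i := by
    intro i
    obtain ⟨b, hb, h⟩ := Set.exists_min_image {y : X | Sum.inl y ∈ S} (fun y ↦ y.1 i)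
      (Set.toFinite _) ⟨a, ha⟩
    exact ⟨b, hb, h⟩
  choose b hbS hb using hmin
  let m : I → ℕ := fun i ↦ if Sum.inr i ∈ S then 0 else (b i).1 i
  have hm : ∀ y : X, Sum.inl y ∈ S → ∀ i, m i ≤ y.1 i := by
    intro y hy i
    by_cases hi : Sum.inr i ∈ S
    · simp [m, hi]
    · simpa [m, hi] using hb i y hy
  -- Otherwise some grid point exceeds `m` in every coordinate, contradicting dominance. As all grid
  -- points of `S` lie above `m` and have sum `N`, they are within `Fintype.card I` of each other in
  -- each coordinate.
  have hN : N ≤ ∑ i, m i + Fintype.card I := by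
    by_contra! hlt
    have hsum : ∑ i, (m i + 1) ≤ N := by
      rw [Finset.sum_add_distrib]
      simp only [Finset.sum_const, Finset.card_univ, smul_eq_mul, mul_one]
      exact hlt.le
    let x : I → ℕ := fun i ↦ m i + 1 + Pi.single (M := fun _ ↦ ℕ) i₁ (N - ∑ i, (m i + 1)) i
    have hx : ∑ i, x i = N := by
      simp only [x]
      rw [Finset.sum_add_distrib, Finset.sum_pi_single']
      simp only [Finset.mem_univ, if_true]
      omega
    obtain ⟨i, hi, h⟩ := hdom ⟨x, (hX x).2 hx⟩
    have h1 := h (b i) (hbS i)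
    have h2 : m i = (b i).1 i := by simp [m, hi]
    change m i + 1 + _ ≤ _ at h1
    omega
  have hup : ∀ y : X, Sum.inl y ∈ S → ∀ i, y.1 i ≤ m i + Fintype.card I := by
    intro y hy
    refine Finset.le_add_of_sum_le (hm y hy) ?_
    rw [(hX _).1 y.2]
    exact hN
  refine ⟨a.1, (hX _).1 a.2, fun i ↦ ?_⟩
  by_cases hi : Sum.inr i ∈ S
  · left
    simpa [m, hi] using hup a ha i
  · right
    obtain ⟨y, hy, hyc⟩ := hcol i hi
    refine ⟨y.1, (hX _).1 y.2, hyc, fun j ↦ ?_⟩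
    have h1 := hup a ha j
    have h2 := hup y hy j
    have h3 := hm a ha j
    have h4 := hm y hy j
    omega

/-- The dual form of the **Knaster–Kuratowski–Mazurkiewicz theorem**: if closed sets `A i` cover
the standard simplex, then some point of the simplex lies in all those `A i` for which its `i`-th
coordinate does not vanish. -/
theorem exists_mem_stdSimplex_forall_eq_zero_or_mem [Nonempty I] {A : I → Set (I → ℝ)}
    (hA : ∀ i, IsClosed (A i)) (hcover : ∀ x ∈ stdSimplex ℝ I, ∃ i, x ∈ A i) :
    ∃ x ∈ stdSimplex ℝ I, ∀ i, x i = 0 ∨ x ∈ A i := by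
  classical
  let B : I → Set (I → ℝ) := fun i ↦ {x | x i = 0} ∪ A i
  have hB : ∀ i, IsClosed (B i) := fun i ↦
    (isClosed_eq (continuous_apply i) continuous_const).union (hA i)
  have hB0 : ∀ i, (B i).Nonempty := fun i ↦ ⟨0, Or.inl rfl⟩
  -- Minimising `g` replaces the extraction of a convergent subsequence: grid points of mesh `1 / N`
  -- make it arbitrarily small, so its minimum is zero.
  let g : (I → ℝ) → ℝ := fun x ↦ ∑ i, Metric.infDist x (B i)
  have hg : Continuous g := continuous_finsetSum _ fun i _ ↦ Metric.continuous_infDist_pt _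
  obtain ⟨x, hx, hmin⟩ := (isCompact_stdSimplex ℝ I).exists_isMinOn
    ⟨_, single_mem_stdSimplex ℝ (Classical.arbitrary I)⟩ hg.continuousOn
  have hbound : ∀ N : ℕ, 0 < N → g x ≤ (Fintype.card I * Fintype.card I : ℝ) / N := by
    intro N hN
    have hN' : (0 : ℝ) < N := by exact_mod_cast hN
    let φ : (I → ℕ) → I → ℝ := fun a i ↦ a i / N
    have hφ : ∀ a : I → ℕ, ∑ i, a i = N → φ a ∈ stdSimplex ℝ I := by
      intro a ha
      refine ⟨fun i ↦ by positivity, ?_⟩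
      simp only [φ]
      rw [← Finset.sum_div, ← Nat.cast_sum, ha, div_self hN'.ne']
    have hc : ∀ a : I → ℕ, ∃ i, ∑ i, a i = N → φ a ∈ A i := by
      intro a
      by_cases ha : ∑ i, a i = N
      · obtain ⟨i, hi⟩ := hcover _ (hφ a ha)
        exact ⟨i, fun _ ↦ hi⟩
      · exact ⟨Classical.arbitrary I, fun h ↦ absurd h ha⟩
    choose c hc using hc
    obtain ⟨a, ha, hac⟩ := exists_grid_point_near_colors N c
    refine (hmin (hφ a ha)).trans ?_
    have hi : ∀ i ∈ Finset.univ, Metric.infDist (φ a) (B i) ≤ (Fintype.card I : ℝ) / N := by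
      intro i _
      rcases hac i with h | ⟨b, hbN, hbc, hb⟩
      · have hmem : Function.update (φ a) i 0 ∈ B i := Or.inl (by simp)
        refine (Metric.infDist_le_dist_of_mem hmem).trans ?_
        rw [dist_pi_le_iff (by positivity)]
        intro j
        by_cases hj : j = i
        · subst hj
          simp only [Function.update_self, φ, dist_zero_right, Real.norm_eq_abs]
          rw [abs_of_nonneg (by positivity)]
          gcongr
        · simp only [Function.update_of_ne hj, dist_self]
          positivity
      · have hmem : φ b ∈ B i := Or.inr (hbc ▸ hc b hbN)
        refine (Metric.infDist_le_dist_of_mem hmem).trans ?_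
        rw [dist_pi_le_iff (by positivity)]
        intro j
        simp only [φ, Real.dist_eq]
        rw [← sub_div, abs_div, abs_of_pos hN']
        gcongr
        obtain ⟨h1, h2⟩ := hb j
        have h1' : (a j : ℝ) ≤ b j + Fintype.card I := by exact_mod_cast h1
        have h2' : (b j : ℝ) ≤ a j + Fintype.card I := by exact_mod_cast h2
        rw [abs_le]
        constructor <;> linarith
    refine (Finset.sum_le_card_nsmul _ _ _ hi).trans_eq ?_
    rw [Finset.card_univ, nsmul_eq_mul, mul_div_assoc]
  have hnonneg : ∀ i ∈ Finset.univ, 0 ≤ Metric.infDist x (B i) :=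
    fun i _ ↦ Metric.infDist_nonneg
  have hg0 : g x ≤ 0 := by
    refine ge_of_tendsto 
      (tendsto_const_div_atTop_nhds_zero_nat (Fintype.card I * Fintype.card I : ℝ)) ?_
    filter_upwards [Filter.eventually_gt_atTop 0] with N hN using hbound N hN
  have hzero := (Finset.sum_eq_zero_iff_of_nonneg hnonneg).1
    (le_antisymm hg0 (Finset.sum_nonneg hnonneg))
  refine ⟨x, hx, fun i ↦ ?_⟩
  exact ((hB i).mem_iff_infDist_zero (hB0 i)).2 (hzero i (Finset.mem_univ i))

end DualKKM

/-! ### Nonvanishing velocity of an immersed circle -/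

section Immersion

open Manifold

theorem Circle.hasDerivAt_coe_exp (t : ℝ) :
    HasDerivAt (fun s : ℝ ↦ (Circle.exp s : ℂ)) (Circle.exp t * Complex.I) t := by
  simp only [Circle.coe_exp]
  have h : HasDerivAt (fun s : ℝ ↦ (s : ℂ) * Complex.I) Complex.I t := by
    simpa using (Complex.ofRealCLM.hasDerivAt (x := t)).mul_const Complex.I
  exact h.cexp

/-- In immersion charts `K` is `u ↦ (u, 0)` up to a linear equivalence, so `L ∘ ψ` recovers the
chart coordinate on the circle from `K`. A zero velocity would thus pass back to `Circle.exp`, whose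
derivative `Circle.exp t * Complex.I` is nonzero. -/
theorem Manifold.IsImmersionAt.deriv_comp_circleExp_ne_zero {E : Type*} [NormedAddCommGroup E]
    [NormedSpace ℝ E] {K : Circle → E} {t : ℝ}
    (hK : IsImmersionAt (𝓡 1) 𝓘(ℝ, E) ∞ K (Circle.exp t)) :
    deriv (fun s ↦ K (Circle.exp s)) t ≠ 0 := by
  intro h0
  have hγ : ContDiffAt ℝ ∞ (fun s ↦ K (Circle.exp s)) t := by
    rw [← contMDiffAt_iff_contDiffAt]
    exact hK.contMDiffAt.comp t contMDiff_circleExp.contMDiffAt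
  have hγ' : HasDerivAt (fun s ↦ K (Circle.exp s)) 0 t :=
    h0 ▸ (hγ.differentiableAt (by simp)).hasDerivAt
  let φ := hK.domChart
  let ψ := hK.codChart
  let L := (ContinuousLinearMap.fst ℝ (EuclideanSpace ℝ (Fin 1)) hK.complement).comp
    hK.equiv.symm.toContinuousLinearMap
  have hψ : ContDiffAt ℝ ∞ ψ (K (Circle.exp t)) := by
    have := contMDiffAt_of_mem_maximalAtlas hK.codChart_mem_maximalAtlas hK.mem_codChart_source
    exact contMDiffAt_iff_contDiffAt.1 this
  have hψγ : HasDerivAt (fun s ↦ L (ψ (K (Circle.exp s)))) 0 t := by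
    have h1 := (hψ.differentiableAt (by simp)).hasFDerivAt.comp_hasDerivAt t hγ'
    have h2 := L.hasFDerivAt.comp_hasDerivAt t h1
    rw [map_zero, map_zero] at h2
    exact h2
  have hsource : ∀ᶠ s in nhds t, Circle.exp s ∈ φ.source :=
    Circle.exp.continuous.continuousAt.eventually
      (φ.open_source.mem_nhds hK.mem_domChart_source)
  have hφ : HasDerivAt (fun s ↦ φ (Circle.exp s)) 0 t := by
    refine hψγ.congr_of_eventuallyEq ?_
    filter_upwards [hsource] with s hs
    have hmem : φ (Circle.exp s) ∈ (φ.extend (𝓡 1)).target := by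
      simpa using φ.map_source hs
    have hw := hK.writtenInCharts hmem
    simp only [Function.comp, OpenPartialHomeomorph.extend_coe, OpenPartialHomeomorph.extend_coe_symm,
      modelWithCornersSelf_coe, modelWithCornersSelf_coe_symm, id] at hw
    have hinv : φ.symm (φ (Circle.exp s)) = Circle.exp s := φ.left_inv hs
    change ψ (K (φ.symm (φ (Circle.exp s)))) = _ at hw
    rw [hinv] at hw
    simp [L, hw]
  have hsymm : ContDiffAt ℝ ∞ (fun u ↦ (φ.symm u : ℂ)) (φ (Circle.exp t)) := by
    have h1 := contMDiffOn_symm_of_mem_maximalAtlas hK.domChart_mem_maximalAtlas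
    have h2 := (h1 _ (φ.map_source hK.mem_domChart_source)).contMDiffAt
      (φ.open_target.mem_nhds (φ.map_source hK.mem_domChart_source))
    have := finrank_real_complex_fact'
    have h3 := (contMDiff_coe_sphere (n := 1) (E := ℂ) (m := ∞)).contMDiffAt.comp _ h2
    exact contMDiffAt_iff_contDiffAt.1 h3
  have hexp : HasDerivAt (fun s : ℝ ↦ (Circle.exp s : ℂ)) 0 t := by
    have h1 := (hsymm.differentiableAt (by simp)).hasFDerivAt.comp_hasDerivAt t hφ
    rw [map_zero] at h1
    refine h1.congr_of_eventuallyEq ?_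
    filter_upwards [hsource] with s hs
    simp only [Function.comp]
    rw [φ.left_inv hs]
  have := hexp.unique (Circle.hasDerivAt_coe_exp t)
  simp at this

end Immersion

/-! ### Chords near a regular point -/

section Chords

variable {E : Type*} [NormedAddCommGroup E] [InnerProductSpace ℝ E]

open scoped InnerProductSpace

theorem HasStrictDerivAt.exists_inner_nonneg {γ : ℝ → E} {v : E} {t : ℝ}
    (h : HasStrictDerivAt γ v t) (hv : v ≠ 0) :
    ∃ δ > 0, ∀ a b c d, |a - t| < δ → |b - t| < δ → |c - t| < δ → |d - t| < δ → a ≤ b → c ≤ d →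
      0 ≤ ⟪γ b - γ a, γ d - γ c⟫_ℝ := by
  have hv' : 0 < ‖v‖ := norm_pos_iff.2 hv
  -- With relative error `1 / 3` the inner product keeps at least the fraction `1 - 1/3 - 1/3 - 1/9
  -- > 0` of its main term.
  have hlip := h.isLittleO.def (c := ‖v‖ / 3) (by positivity)
  obtain ⟨δ, hδ, H⟩ := Metric.eventually_nhds_iff.1 hlip
  have key : ∀ a b, |a - t| < δ → |b - t| < δ → a ≤ b →
      ‖γ b - γ a - (b - a) • v‖ ≤ ‖v‖ / 3 * (b - a) := by
    intro a b ha hb hab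
    have := H (y := (b, a)) (by
      rw [Prod.dist_eq]
      exact max_lt hb ha)
    rw [Real.norm_of_nonneg (sub_nonneg.2 hab)] at this
    simpa using this
  refine ⟨δ, hδ, fun a b c d ha hb hc hd hab hcd ↦ ?_⟩
  have h1 := key a b ha hb hab
  have h2 := key c d hc hd hcd
  set e₁ := γ b - γ a - (b - a) • v with he₁
  set e₂ := γ d - γ c - (d - c) • v with he₂
  have hb' : γ b - γ a = (b - a) • v + e₁ := by rw [he₁]; abel
  have hd' : γ d - γ c = (d - c) • v + e₂ := by rw [he₂]; abel
  have hx : 0 ≤ b - a := sub_nonneg.2 hab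
  have hy : 0 ≤ d - c := sub_nonneg.2 hcd
  rw [hb', hd', inner_add_left, inner_add_right, inner_add_right, real_inner_smul_left,
    real_inner_smul_left, real_inner_smul_right, real_inner_smul_right,
    real_inner_self_eq_norm_sq]
  have i1 : -(‖v‖ * (‖v‖ / 3 * (d - c))) ≤ ⟪v, e₂⟫_ℝ :=
    (neg_le_neg (mul_le_mul_of_nonneg_left h2 hv'.le)).trans
      (neg_le_of_abs_le (abs_real_inner_le_norm v e₂))
  have i2 : -(‖v‖ / 3 * (b - a) * ‖v‖) ≤ ⟪e₁, v⟫_ℝ :=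
    (neg_le_neg (mul_le_mul_of_nonneg_right h1 hv'.le)).trans
      (neg_le_of_abs_le (abs_real_inner_le_norm e₁ v))
  have i3 : -(‖v‖ / 3 * (b - a) * (‖v‖ / 3 * (d - c))) ≤ ⟪e₁, e₂⟫_ℝ :=
    (neg_le_neg (mul_le_mul h1 h2 (norm_nonneg _) (by positivity))).trans
      (neg_le_of_abs_le (abs_real_inner_le_norm e₁ e₂))
  have j1 := mul_le_mul_of_nonneg_left i1 hx
  have j2 := mul_le_mul_of_nonneg_left i2 hy
  have j3 : 0 ≤ (b - a) * (d - c) * ‖v‖ ^ 2 := by positivity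
  linarith

/-- Near a point where a curve has a nonzero strict derivative, the chord of an arc is no shorter
than the chord of any smaller arc. -/
theorem HasStrictDerivAt.exists_dist_le_dist {γ : ℝ → E} {v : E} {t : ℝ}
    (h : HasStrictDerivAt γ v t) (hv : v ≠ 0) :
    ∃ δ > 0, ∀ a b c d, t - δ < c → c ≤ a → a ≤ b → b ≤ d → d < t + δ →
      dist (γ a) (γ b) ≤ dist (γ c) (γ d) := by
  obtain ⟨δ, hδ, H⟩ := h.exists_inner_nonneg hv
  refine ⟨δ, hδ, fun a b c d hc hca hab hbd hd ↦ ?_⟩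
  have hmem : ∀ {x}, c ≤ x → x ≤ d → |x - t| < δ := fun h1 h2 ↦ by
    rw [abs_lt]; constructor <;> linarith
  have hA : |a - t| < δ := hmem hca (hab.trans hbd)
  have hB : |b - t| < δ := hmem (hca.trans hab) hbd
  have hC : |c - t| < δ := hmem le_rfl (hca.trans (hab.trans hbd))
  have hD : |d - t| < δ := hmem (hca.trans (hab.trans hbd)) le_rfl
  have h1 := H a b c a hA hB hC hA hab hca
  have h2 := H a b b d hA hB hB hD hab hbd
  rw [dist_comm (γ a), dist_comm (γ c), dist_eq_norm, dist_eq_norm]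
  -- The two outer chords have nonnegative inner product with the inner one, so adding them cannot
  -- decrease the norm.
  have hsplit : γ d - γ c = (γ b - γ a) + ((γ a - γ c) + (γ d - γ b)) := by abel
  have hsq := norm_add_sq_real (γ b - γ a) ((γ a - γ c) + (γ d - γ b))
  rw [← hsplit, inner_add_right] at hsq
  refine (sq_le_sq₀ (norm_nonneg _) (norm_nonneg _)).1 ?_
  nlinarith [sq_nonneg ‖γ a - γ c + (γ d - γ b)‖]

end Chords

/-! ### Partial sums as subdivision points -/

section PartialSums

variable {n : ℕ}

theorem sum_Iic_le_sum_Iio {s : Fin n → ℝ} (hs : ∀ i, 0 ≤ s i) {i j : Fin n} (hij : i < j) :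
    ∑ k ∈ Finset.Iic i, s k ≤ ∑ k ∈ Finset.Iio j, s k :=
  Finset.sum_le_sum_of_subset_of_nonneg
    (fun _ hk ↦ Finset.mem_Iio.2 ((Finset.mem_Iic.1 hk).trans_lt hij)) fun k _ _ ↦ hs k

theorem sum_Iic_eq_add_sum_Iio (s : Fin n → ℝ) (i : Fin n) :
    ∑ k ∈ Finset.Iic i, s k = s i + ∑ k ∈ Finset.Iio i, s k := by
  rw [← Finset.Iio_insert, Finset.sum_insert (by simp)]

theorem sum_Iic_le_one {s : Fin n → ℝ} (hs : s ∈ stdSimplex ℝ (Fin n)) (i : Fin n) :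
    ∑ k ∈ Finset.Iic i, s k ≤ 1 := by
  rw [← hs.2]
  exact Finset.sum_le_sum_of_subset_of_nonneg (Finset.subset_univ _) fun k _ _ ↦ hs.1 k

/-- If a periodic function is evaluated along the partial sums of a point of the simplex, then
each step ends where the cyclically next one begins. -/
theorem Function.Periodic.apply_sum_Iic {E : Type*} [NeZero n] {γ : ℝ → E} {T : ℝ}
    (hper : Function.Periodic γ T) (θ : ℝ) {s : Fin n → ℝ} (hs : s ∈ stdSimplex ℝ (Fin n))
    (i : Fin n) :
    γ (θ + T * ∑ k ∈ Finset.Iic i, s k) = γ (θ + T * ∑ k ∈ Finset.Iio (i + 1), s k) := by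
  obtain ⟨m, rfl⟩ := Nat.exists_eq_succ_of_ne_zero (NeZero.ne n)
  induction i using Fin.lastCases with
  | last =>
    have h1 : Finset.Iic (Fin.last m) = Finset.univ := by
      ext k
      simp [Fin.le_last]
    have h2 : Finset.Iio (Fin.last m + 1) = ∅ := by
      ext k
      simp [Fin.last_add_one]
    rw [h1, h2, hs.2, Finset.sum_empty, mul_one, mul_zero, add_zero]
    exact hper θ
  | cast i =>
    have h : Finset.Iio (i.castSucc + 1) = Finset.Iic i.castSucc := by
      ext k
      rw [Fin.coeSucc_eq_succ, Finset.mem_Iio, Finset.mem_Iic, Fin.lt_def, Fin.le_def]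
      simp
    rw [h]

end PartialSums

/-! ### Equal chords on a closed curve, and the theorem -/

/-- On a simple closed curve with parameter `θ`, near which the chords of larger arcs are not
shorter, there are `n ≥ 2` points in cyclic order, the first of them at `θ`, whose consecutive
distances are all equal. -/
theorem exists_strictMono_dist_eq {E : Type*} [MetricSpace E] {γ : ℝ → E} (hγ : Continuous γ)
    {T : ℝ} (hT : 0 < T) (hper : Function.Periodic γ T)
    (hinj : ∀ x y, γ x = γ y → ∃ m : ℤ, x = y + m * T) {θ δ : ℝ} (hδ : 0 < δ)
    (hmono : ∀ a b c d, θ - δ < c → c ≤ a → a ≤ b → b ≤ d → d < θ + δ →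
      dist (γ a) (γ b) ≤ dist (γ c) (γ d))
    {n : ℕ} [NeZero n] (hn : 2 ≤ n) :
    ∃ t : Fin n → ℝ, StrictMono t ∧ t 0 = θ ∧ (∀ i, θ ≤ t i) ∧ (∀ i, t i < θ + T) ∧
      ∃ d, ∀ i, dist (γ (t i)) (γ (t (i + 1))) = d := by
  have : Nontrivial (Fin n) := Fin.nontrivial_iff_two_le.2 hn
  let τ : (Fin n → ℝ) → Fin n → ℝ := fun s i ↦ θ + T * ∑ k ∈ Finset.Iio i, s k
  let σ : (Fin n → ℝ) → Fin n → ℝ := fun s i ↦ θ + T * ∑ k ∈ Finset.Iic i, s k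
  let f : Fin n → (Fin n → ℝ) → ℝ := fun i s ↦ dist (γ (τ s i)) (γ (σ s i))
  have hf : ∀ i, Continuous (f i) := by
    intro i
    refine Continuous.dist (hγ.comp ?_) (hγ.comp ?_) <;> fun_prop
  have hστ : ∀ s i, σ s i = τ s i + T * s i := by
    intro s i
    simp only [σ, τ, sum_Iic_eq_add_sum_Iio]
    ring
  have hθτ : ∀ s ∈ stdSimplex ℝ (Fin n), ∀ i, θ ≤ τ s i := by
    intro s hs i
    exact le_add_of_nonneg_right (mul_nonneg hT.le (Finset.sum_nonneg fun k _ ↦ hs.1 k))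
  have hσθ : ∀ s ∈ stdSimplex ℝ (Fin n), ∀ i, σ s i ≤ θ + T := by
    intro s hs i
    have := mul_le_mul_of_nonneg_left (sum_Iic_le_one hs i) hT.le
    simp only [σ]
    linarith
  have hστ_le : ∀ s ∈ stdSimplex ℝ (Fin n), ∀ i j, i < j → σ s i ≤ τ s j := by
    intro s hs i j hij
    have := mul_le_mul_of_nonneg_left (sum_Iic_le_sum_Iio hs.1 hij) hT.le
    simp only [σ, τ]
    linarith
  have hτσ : ∀ s ∈ stdSimplex ℝ (Fin n), ∀ i, τ s i ≤ σ s i := by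
    intro s hs i
    rw [hστ]
    exact le_add_of_nonneg_right (mul_nonneg hT.le (hs.1 i))
  -- The complement of the `i`-th arc runs from `σ s i - T` to `τ s i`, within `δ` of `θ`. It has
  -- the same chord and contains every other arc, those with `j > i` after a shift by `-T`.
  have hlong : ∀ s ∈ stdSimplex ℝ (Fin n), ∀ i, T * (1 - s i) < δ → ∀ j, f j s ≤ f i s := by
    intro s hs i hi j
    have hfi : f i s = dist (γ (σ s i - T)) (γ (τ s i)) := by
      rw [hper.sub_eq, dist_comm]
    have hc : θ - δ < σ s i - T := by
      have := hθτ s hs i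
      rw [hστ]
      linarith
    have hd : τ s i < θ + δ := by
      have := hσθ s hs i
      rw [hστ] at this
      linarith
    rcases lt_trichotomy j i with hji | rfl | hij
    · rw [hfi]
      have h1 := hσθ s hs i
      have h2 := hθτ s hs j
      exact hmono _ _ _ _ hc (by linarith) (hτσ s hs j) (hστ_le s hs j i hji) hd
    · exact le_rfl
    · have hfj : f j s = dist (γ (τ s j - T)) (γ (σ s j - T)) := by
        rw [hper.sub_eq, hper.sub_eq]
      rw [hfi, hfj]
      have h1 := hστ_le s hs i j hij
      have h2 := hσθ s hs j
      have h3 := hθτ s hs i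
      have h4 := hτσ s hs j
      exact hmono _ _ _ _ hc (by linarith) (by linarith) (by linarith) hd
  -- `T * ε ≤ δ` makes `hlong` apply once `s i > 1 - ε`; `ε ≤ 1 / 2` makes any other arc then
  -- satisfy `s j < ε ≤ 1 - ε`.
  obtain ⟨ε, hε, hε2, hεδ⟩ : ∃ ε > 0, ε ≤ 1 / 2 ∧ T * ε ≤ δ := by
    refine ⟨min (1 / 2) (δ / T), by positivity, min_le_left _ _, ?_⟩
    calc T * min (1 / 2) (δ / T) ≤ T * (δ / T) := by gcongr; exact min_le_right _ _
      _ = δ := by field_simp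
  let A : Fin n → Set (Fin n → ℝ) := fun i ↦ {s | (∀ j, f i s ≤ f j s) ∧ s i ≤ 1 - ε}
  have hA : ∀ i, IsClosed (A i) := by
    intro i
    have h : A i = (⋂ j, {s | f i s ≤ f j s}) ∩ {s | s i ≤ 1 - ε} := by
      ext s
      simp [A]
    rw [h]
    exact (isClosed_iInter fun j ↦ isClosed_le (hf i) (hf j)).inter
      (isClosed_le (continuous_apply i) continuous_const)
  have hcover : ∀ s ∈ stdSimplex ℝ (Fin n), ∃ i, s ∈ A i := by
    intro s hs
    obtain ⟨i, -, hi⟩ := Finset.exists_min_image Finset.univ (fun i ↦ f i s) Finset.univ_nonempty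
    by_cases his : s i ≤ 1 - ε
    · exact ⟨i, fun j ↦ hi j (Finset.mem_univ j), his⟩
    · push Not at his
      obtain ⟨j, hj⟩ := exists_ne i
      refine ⟨j, fun k ↦ ?_, ?_⟩
      · refine (hlong s hs i ?_ j).trans (hi k (Finset.mem_univ k))
        nlinarith
      · have hle : ∑ k ∈ ({i, j} : Finset (Fin n)), s k ≤ ∑ k, s k :=
          Finset.sum_le_sum_of_subset_of_nonneg (Finset.subset_univ _) fun k _ _ ↦ hs.1 k
        rw [hs.2, Finset.sum_pair hj.symm] at hle
        linarith
  obtain ⟨s, hs, hsA⟩ := exists_mem_stdSimplex_forall_eq_zero_or_mem hA hcover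
  have hf0 : ∀ i, s i = 0 → f i s = 0 := by
    intro i hi
    simp only [f, hστ, hi, mul_zero, add_zero, dist_self]
  have hmem : ∀ i, s ∈ A i := by
    intro i
    rcases hsA i with h | h
    · refine ⟨fun j ↦ ?_, ?_⟩
      · rw [hf0 i h]
        exact dist_nonneg
      · rw [h]
        linarith
    · exact h
  have hpos : ∀ i, 0 < s i := by
    intro i
    refine lt_of_le_of_ne (hs.1 i) fun h ↦ ?_
    -- One empty arc makes the least chord zero, so all chords vanish. Injectivity modulo `T` makes
    -- each `s j` an integer, and the bound `1 - ε` excludes the full turn.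
    have hall : ∀ j, s j = 0 := by
      intro j
      have hfj : f j s = 0 := le_antisymm (((hmem j).1 i).trans_eq (hf0 i h.symm)) dist_nonneg
      obtain ⟨m, hm⟩ := hinj _ _ (dist_eq_zero.1 hfj)
      rw [hστ] at hm
      have hsm : s j = ((-m : ℤ) : ℝ) := by
        have : T * (s j + m) = 0 := by linarith
        have := (mul_eq_zero.1 this).resolve_left hT.ne'
        push_cast
        linarith
      have hlt : s j < 1 := (hmem j).2.trans_lt (by linarith)
      have hge := hs.1 j
      rw [hsm] at hlt hge ⊢
      have h1 : -m < 1 := by exact_mod_cast hlt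
      have h2 : 0 ≤ -m := by exact_mod_cast hge
      have h3 : -m = 0 := by omega
      rw [h3, Int.cast_zero]
    have := hs.2
    simp [hall] at this
  have hlt : ∀ i, τ s i < σ s i := by
    intro i
    rw [hστ]
    exact lt_add_of_pos_right _ (mul_pos hT (hpos i))
  refine ⟨τ s, fun i j hij ↦ (hlt i).trans_le (hστ_le s hs i j hij), ?_, hθτ s hs,
    fun i ↦ (hlt i).trans_le (hσθ s hs i), f 0 s, fun i ↦ ?_⟩
  · have h : Finset.Iio (0 : Fin n) = ∅ := by
      ext k
      simp
    simp [τ, h]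
  · rw [show γ (τ s (i + 1)) = γ (σ s i) from (hper.apply_sum_Iic θ hs i).symm]
    exact le_antisymm ((hmem i).1 0) ((hmem 0).1 i)

theorem theorem1 (K : Circle → EuclideanSpace ℝ (Fin 3)) (hK : IsSmoothKnot K)
    (x₀ : EuclideanSpace ℝ (Fin 3)) (hx₀ : x₀ ∈ Set.range K) (n : ℕ) [NeZero n] :
    ∃ x : Fin n → EuclideanSpace ℝ (Fin 3),
      IsInscribedRegularPolygon K x ∧ x₀ ∈ Set.range x := by
  obtain ⟨p, rfl⟩ := hx₀
  obtain ⟨θ, rfl⟩ : ∃ θ, Circle.exp θ = p := ⟨_, Circle.exp_arg p⟩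
  suffices h : ∃ t : Fin n → ℝ, StrictMono t ∧ t 0 = θ ∧ (∀ i, θ ≤ t i) ∧
      (∀ i, t i < θ + 2 * Real.pi) ∧
      ∃ d, ∀ i, dist (K (Circle.exp (t i))) (K (Circle.exp (t (i + 1)))) = d by
    obtain ⟨t, ht, ht0, hle, hlt, hd⟩ := h
    refine ⟨fun i ↦ K (Circle.exp (t i)), ⟨⟨fun i ↦ Circle.exp (t i), ⟨t, ht, fun i j ↦ ?_,
      fun _ ↦ rfl⟩, fun _ ↦ rfl⟩, hd⟩, 0, by simp only [ht0]⟩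
    linarith [hle i, hlt j]
  rcases Nat.lt_or_ge n 2 with hn | hn
  -- With a single arc there is no second index to cover the vertex of the simplex; the polygon is
  -- just the point `x₀`.
  · obtain rfl : n = 1 := by
      have := NeZero.pos n
      omega
    refine ⟨fun _ ↦ θ, Subsingleton.strictMono _, rfl, fun _ ↦ le_rfl, fun _ ↦ ?_, 0,
      fun _ ↦ dist_self _⟩
    linarith [Real.pi_pos]
  have hγ : ContDiff ℝ ∞ fun s ↦ K (Circle.exp s) :=
    contMDiff_iff_contDiff.1 (hK.contMDiff.comp contMDiff_circleExp)
  have hne := (hK.isImmersion.isImmersionAt (Circle.exp θ)).deriv_comp_circleExp_ne_zero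
  obtain ⟨δ, hδ, hmono⟩ :=
    (hγ.contDiffAt.hasStrictDerivAt (x := θ) (by simp)).exists_dist_le_dist hne
  exact exists_strictMono_dist_eq hγ.continuous Real.two_pi_pos
    (fun s ↦ by simp only [Circle.exp_add_two_pi])
    (fun x y h ↦ Circle.exp_eq_exp.1 (hK.isEmbedding.injective h)) hδ hmono hn
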